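/- Let $(\Omega,\mathcal B,\nu)$ be an atomless standard probability space; here standard means that $\mathcal B$ is the $\sigma$-algebra of a standard Borel space or its completion with respect to $\nu$ (for example, the Borel or the Lebesgue measurable sets of $[0,1]$ with Lebesgue measure). A graphon is a symmetric measurable function $W:\Omega^2\to[0,1]$, where functions that are equal $\nu^{\otimes 2}$-almost everywhere are identified. For a bijection $\varphi:\Omega\to\Omega$ that is measure preserving (measurable with measurable inverse), write $W^{\varphi}(x,y)=W(\varphi(x),\varphi(y))$. The envelope $\langle W\rangle$ of a graphon $W$ is the set of all graphons $U$ for which there is a sequence $\varphi_1,\varphi_2,\ldots$ of measure preserving bijections of $\Omega$ such that $W^{\varphi_n}$ converges weak* to $U$, that is, $\int_Q W^{\varphi_n}\,d\nu^{\otimes 2}\to\int_Q U\,d\nu^{\otimes 2}$ for every measurable $Q\subseteq\Omega^2$. Theorem. For every graphon $W$ and every sub-$\sigma$-algebra $\mathcal A\subseteq\mathcal B$, the conditional expectation $\mathbb E[W\mid\mathcal A\times\mathcal A]$ of $W$ with respect to the product $\sigma$-algebra $\mathcal A\times\mathcal A$ lies in $\langle W\rangle$. -/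

import Mathlib

open MeasureTheory Filter Topology

/-- `(Ω, ν)` is a standard probability space: its measurable sets are either the Borel sets of a
standard Borel space, or the `ν`-completion of such a Borel σ-algebra `m₀` (so that both the Borel
and the Lebesgue measurable sets of the unit interval are covered). -/
def IsStandardProbabilitySpace {Ω : Type*} [mΩ : MeasurableSpace Ω] (ν : Measure Ω) : Prop :=
  StandardBorelSpace Ω ∨
    ∃ (m₀ : MeasurableSpace Ω) (h : m₀ ≤ mΩ), @StandardBorelSpace Ω m₀ ∧
      ∀ s : Set Ω, MeasurableSet[mΩ] s ↔ @NullMeasurableSet Ω m₀ s (ν.trim h)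

/-- `W` represents a graphon on `(Ω, ν)`: a symmetric measurable function from `Ω²` to `[0,1]`,
functions being considered up to equality almost everywhere. -/
structure IsGraphon {Ω : Type*} [MeasurableSpace Ω] (ν : Measure Ω) (W : Ω × Ω → ℝ) : Prop where
  aemeasurable : AEMeasurable W (ν.prod ν)
  mem_Icc : ∀ᵐ p ∂(ν.prod ν), W p ∈ Set.Icc (0 : ℝ) 1
  symm : ∀ᵐ p ∂(ν.prod ν), W p.swap = W p

/-- The function `W^φ (x, y) = W (φ x, φ y)`; for a measure preserving bijection `φ` this is a
version of `W`. -/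
def graphonVersion {Ω : Type*} (W : Ω × Ω → ℝ) (φ : Ω → Ω) : Ω × Ω → ℝ :=
  fun p => W (φ p.1, φ p.2)

/-- Weak* convergence of a sequence of graphons: `∫_Q Γ n → ∫_Q W` for each measurable
`Q ⊆ Ω²`. -/
def WeakStarTendsto {Ω : Type*} [MeasurableSpace Ω] (ν : Measure Ω)
    (Γ : ℕ → Ω × Ω → ℝ) (W : Ω × Ω → ℝ) : Prop :=
  ∀ Q : Set (Ω × Ω), MeasurableSet Q →
    Tendsto (fun n => ∫ p in Q, Γ n p ∂(ν.prod ν)) atTop (𝓝 (∫ p in Q, W p ∂(ν.prod ν)))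

/-- `LIM(Γ 0, Γ 1, …)`: the graphons that are weak* limits of a sequence of versions of the
`Γ n`. A measurable equivalence `Ω ≃ᵐ Ω` which preserves `ν` is a measure preserving bijection
of `Ω`. -/
def graphonLIM {Ω : Type*} [MeasurableSpace Ω] (ν : Measure Ω) (Γ : ℕ → Ω × Ω → ℝ) :
    Set (Ω × Ω → ℝ) :=
  {U | IsGraphon ν U ∧ ∃ φ : ℕ → Ω ≃ᵐ Ω, (∀ n, MeasurePreserving (φ n) ν ν) ∧
    WeakStarTendsto ν (fun n => graphonVersion (Γ n) (φ n)) U}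

/-- The envelope `⟨W⟩ = LIM(W, W, W, …)` of a graphon. -/
def graphonEnvelope {Ω : Type*} [MeasurableSpace Ω] (ν : Measure Ω) (W : Ω × Ω → ℝ) :
    Set (Ω × Ω → ℝ) :=
  graphonLIM ν (fun _ => W)

/-! The relatively independent self-joining of `ν` over `A`, with `K(B, C) = ∫ E[1_B | A] E[1_C | A]
dν`, is a symmetric coupling of `ν` with itself, and symmetric couplings are limits of graphs of
measure preserving involutions. To see the latter, identify the space with `(0, 1]`, cut it into `N`
cells `C i` of equal length, and cut each `C i` into consecutive intervals of lengths `K (C i) (C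
j)`. By symmetry the pieces `(i, j)` and `(j, i)` have equal length; exchanging them by translation
gives an involution that reproduces `K` exactly on the cells
(`exists_involutive_measureReal_cells`).

With `N = n!` every rational threshold is eventually a cell boundary, so the graphs converge to `K`
on a generating π-system, and domination by `ν` extends this to all measurable rectangles
(`tendsto_condCoupling_of_isPiSystem`). For `φ n × φ n` the limit on rectangles is a product of two
values of `K`, which is the relatively independent joining over `A × A` because conditional
expectation factors on rectangles (`condExp_prod_indicator`). Approximating `W` in L¹ by simple
functions then turns convergence of graphs into weak convergence of `W ∘ (φ n × φ n)` to `E[W | A ×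
A]` (`tendsto_setIntegral_comp_condExp`). -/

/-! ### Atomless standard Borel spaces and the unit interval. -/

theorem continuous_cdf_of_nullSingletonClass (μ : Measure ℝ) [IsProbabilityMeasure μ]
    [NullSingletonClass μ] : Continuous (ProbabilityTheory.cdf μ) := by
  rw [continuous_iff_continuousAt]
  intro x
  rw [(ProbabilityTheory.monotone_cdf μ).continuousAt_iff_leftLim_eq_rightLim,
    StieltjesFunction.rightLim_eq]
  have h := StieltjesFunction.measure_singleton (ProbabilityTheory.cdf μ) x
  rw [ProbabilityTheory.measure_cdf, measure_singleton, eq_comm, ENNReal.ofReal_eq_zero] at h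
  exact le_antisymm ((ProbabilityTheory.monotone_cdf μ).leftLim_le le_rfl) (by linarith)

/-- The probability integral transform. -/
theorem map_cdf_eq_restrict_Ioc (μ : Measure ℝ) [IsProbabilityMeasure μ] [NullSingletonClass μ] :
    μ.map (ProbabilityTheory.cdf μ) = volume.restrict (Set.Ioc 0 1) := by
  have hc := continuous_cdf_of_nullSingletonClass μ
  have hivt : ∀ t : ℝ, 0 < t → t < 1 → ∃ x, ProbabilityTheory.cdf μ x = t := by
    intro t h0 h1
    obtain ⟨a, ha⟩ := ((ProbabilityTheory.tendsto_cdf_atBot μ).eventually_lt_const h0).exists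
    obtain ⟨b, hb⟩ := ((ProbabilityTheory.tendsto_cdf_atTop μ).eventually_const_lt h1).exists
    exact mem_range_of_exists_le_of_exists_ge hc ⟨a, ha.le⟩ ⟨b, hb.le⟩
  have : IsProbabilityMeasure (μ.map (ProbabilityTheory.cdf μ)) :=
    Measure.isProbabilityMeasure_map hc.measurable.aemeasurable
  refine Measure.ext_of_Iic _ _ fun t => ?_
  rw [Measure.map_apply hc.measurable measurableSet_Iic, Measure.restrict_apply measurableSet_Iic,
    Set.inter_comm, Set.Ioc_inter_Iic, Real.volume_Ioc]
  rcases le_or_gt 1 t with h1 | h1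
  · rw [min_eq_left h1, Set.eq_univ_of_forall (s := ProbabilityTheory.cdf μ ⁻¹' Set.Iic t)
      fun x => (ProbabilityTheory.cdf_le_one μ x).trans h1]
    simp
  rw [min_eq_right h1.le, sub_zero]
  apply le_antisymm
  · rcases lt_or_ge t 0 with h0 | h0
    · have : ProbabilityTheory.cdf μ ⁻¹' Set.Iic t = ∅ := by
        ext x
        simpa using h0.trans_le (ProbabilityTheory.cdf_nonneg μ x)
      simp [this]
    · have key : ∀ s ∈ Set.Ioo t 1,
          μ (ProbabilityTheory.cdf μ ⁻¹' Set.Iic t) ≤ ENNReal.ofReal s := by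
        rintro s ⟨hts, hs⟩
        obtain ⟨x, rfl⟩ := hivt s (h0.trans_lt hts) hs
        rw [ProbabilityTheory.ofReal_cdf]
        refine measure_mono fun y hy => ?_
        by_contra hxy
        exact absurd ((ProbabilityTheory.monotone_cdf μ) (not_le.1 hxy).le)
          (not_le.2 (lt_of_le_of_lt hy hts))
      have hlim : Tendsto ENNReal.ofReal (𝓝[>] t) (𝓝 (ENNReal.ofReal t)) :=
        (ENNReal.continuous_ofReal.tendsto t).mono_left nhdsWithin_le_nhds
      refine ge_of_tendsto hlim ?_
      filter_upwards [Ioo_mem_nhdsGT h1] with s hs using key s hs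
  · rcases le_or_gt t 0 with h0 | h0
    · simp [ENNReal.ofReal_of_nonpos h0]
    · obtain ⟨x, rfl⟩ := hivt t h0 h1
      rw [ProbabilityTheory.ofReal_cdf]
      exact measure_mono fun y hy => ProbabilityTheory.monotone_cdf μ hy

/-- Two points with the same cdf value enclose a rational with that value too. Discarding the
preimage of the countably many values at rationals leaves an injective map, and this preimage is
null since the cdf pushes `μ` to Lebesgue measure. -/
theorem exists_injOn_cdf (μ : Measure ℝ) [IsProbabilityMeasure μ] [NullSingletonClass μ] :
    ∃ G : Set ℝ, MeasurableSet G ∧ μ Gᶜ = 0 ∧ Set.InjOn (ProbabilityTheory.cdf μ) G := by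
  have hc := continuous_cdf_of_nullSingletonClass μ
  set D : Set ℝ := Set.range fun q : ℚ => ProbabilityTheory.cdf μ q
  have hD : D.Countable := Set.countable_range _
  refine ⟨(ProbabilityTheory.cdf μ ⁻¹' D)ᶜ, (hc.measurable hD.measurableSet).compl, ?_, ?_⟩
  · rw [compl_compl, ← Measure.map_apply hc.measurable hD.measurableSet,
      map_cdf_eq_restrict_Ioc]
    exact hD.measure_zero _
  · have key : ∀ x y, y ∈ (ProbabilityTheory.cdf μ ⁻¹' D)ᶜ → x < y →
        ProbabilityTheory.cdf μ x ≠ ProbabilityTheory.cdf μ y := by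
      intro x y hy hxy he
      obtain ⟨q, h1, h2⟩ := exists_rat_btwn hxy
      refine hy ⟨q, le_antisymm (ProbabilityTheory.monotone_cdf μ h2.le) ?_⟩
      rw [← he]
      exact ProbabilityTheory.monotone_cdf μ h1.le
    intro x hx y hy he
    rcases lt_trichotomy x y with h | h | h
    · exact absurd he (key x y hy h)
    · exact h
    · exact absurd he.symm (key y x hx h)

/-- An atomless standard Borel probability space is isomorphic modulo null sets to the unit
interval. -/
theorem exists_map_eq_restrict_Ioc {X : Type*} [MeasurableSpace X] [StandardBorelSpace X]
    (ν : Measure X) [IsProbabilityMeasure ν] [NullSingletonClass ν] :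
    ∃ (h : X → ℝ) (g : ℝ → X), Measurable h ∧ Measurable g ∧ (∀ x, h x ∈ Set.Ioc (0 : ℝ) 1) ∧
      ν.map h = volume.restrict (Set.Ioc 0 1) ∧ ∀ᵐ x ∂ν, g (h x) = x := by
  have hX : Nonempty X := nonempty_of_isProbabilityMeasure ν
  have hf := measurableEmbedding_embeddingReal X
  set f := embeddingReal X
  set μ := ν.map f with hμ
  have : IsProbabilityMeasure μ := Measure.isProbabilityMeasure_map hf.measurable.aemeasurable
  have : NullSingletonClass μ := by
    refine ⟨fun t => ?_⟩
    rw [hμ, Measure.map_apply hf.measurable (measurableSet_singleton t)]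
    exact Set.Subsingleton.measure_zero (fun x hx y hy => hf.injective (hx.trans hy.symm)) ν
  obtain ⟨G, hG, hG0, hGi⟩ := exists_injOn_cdf μ
  have hc := (continuous_cdf_of_nullSingletonClass μ).measurable
  set F := fun x => ProbabilityTheory.cdf μ (f x) with hF
  have hFm : Measurable F := hc.comp hf.measurable
  have hFmap : ν.map F = volume.restrict (Set.Ioc 0 1) := by
    rw [← map_cdf_eq_restrict_Ioc μ, hμ, Measure.map_map (by exact hc) hf.measurable]
    rfl
  have hF0 : ∀ᵐ x ∂ν, F x ∈ Set.Ioc (0 : ℝ) 1 := by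
    have : ∀ᵐ t ∂(ν.map F), t ∈ Set.Ioc (0 : ℝ) 1 := by
      rw [hFmap]
      exact ae_restrict_mem measurableSet_Ioc
    exact ae_of_ae_map hFm.aemeasurable this
  classical
  -- The value `1` on the null set where `F` leaves `(0, 1]` makes the range condition hold
  -- everywhere.
  set h : X → ℝ := fun x => if F x ∈ Set.Ioc (0 : ℝ) 1 then F x else 1 with hh
  have hhm : Measurable h :=
    Measurable.ite (hFm measurableSet_Ioc) hFm measurable_const
  have hhF : h =ᵐ[ν] F := by
    filter_upwards [hF0] with x hx
    exact if_pos hx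
  set G' := f ⁻¹' G ∩ F ⁻¹' Set.Ioc 0 1
  have hG' : MeasurableSet G' := (hf.measurable hG).inter (hFm measurableSet_Ioc)
  -- An injective measurable map on a standard Borel space is a measurable embedding
  -- (Lusin–Souslin); `g` extends its inverse.
  have hemb : MeasurableEmbedding fun x : G' => h x := by
    have : StandardBorelSpace G' := hG'.standardBorel
    refine Measurable.measurableEmbedding (hhm.comp measurable_subtype_coe) ?_
    rintro ⟨x, hx⟩ ⟨y, hy⟩ hxy
    have hx2 : h x = F x := if_pos hx.2
    have hy2 : h y = F y := if_pos hy.2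
    have hxy' : F x = F y := by rw [← hx2, ← hy2]; exact hxy
    exact Subtype.ext (hf.injective (hGi hx.1 hy.1 hxy'))
  obtain ⟨g, hg, hgh⟩ := hemb.exists_measurable_extend (g := fun x : G' => (x : X))
    measurable_subtype_coe fun _ => hX
  refine ⟨h, g, hhm, hg, fun x => ?_, ?_, ?_⟩
  · simp only [hh]
    split_ifs with hx
    · exact hx
    · simp
  · rw [Measure.map_congr hhF, hFmap]
  · have hG1 : ∀ᵐ x ∂ν, f x ∈ G := by
      rw [hμ, Measure.map_apply hf.measurable hG.compl] at hG0
      exact hG0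
    filter_upwards [hF0, hG1] with x h1 h2
    exact congrFun hgh ⟨x, h2, h1⟩

/-! ### Involutions glued from pieces. -/

/-- The map is `g k` on `P k` and the identity off all pieces. Preservation of measure is additivity
over the pieces, followed by reindexing the sum along the permutation `σ`. -/
theorem exists_involutive_measurePreserving_of_pieces {X ι : Type*} [MeasurableSpace X]
    (μ : Measure X) [Countable ι] (P : ι → Set X) (hP : ∀ k, MeasurableSet (P k))
    (hd : Pairwise (Function.onFun Disjoint P)) (σ : ι → ι) (hσ : Function.Involutive σ)
    (g : ι → X → X) (hg : ∀ k, Measurable (g k)) (hmaps : ∀ k, ∀ x ∈ P k, g k x ∈ P (σ k))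
    (hinv : ∀ k, ∀ x ∈ P k, g (σ k) (g k x) = x)
    (hμ : ∀ k S, MeasurableSet S → μ (P k ∩ g k ⁻¹' S) = μ (P (σ k) ∩ S)) :
    ∃ φ : X → X, Function.Involutive φ ∧ MeasurePreserving φ μ μ ∧
      ∀ k, ∀ x ∈ P k, φ x = g k x := by
  classical
  set φ : X → X := fun x => if hx : ∃ k, x ∈ P k then g hx.choose x else x with hφ
  have h1 : ∀ k, ∀ x ∈ P k, φ x = g k x := by
    intro k x hx
    have hex : ∃ k, x ∈ P k := ⟨k, hx⟩
    have : hex.choose = k := by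
      by_contra hne
      exact Set.disjoint_left.1 (hd hne) hex.choose_spec hx
    simp only [hφ, dif_pos hex, this]
  have h2 : ∀ x, (¬ ∃ k, x ∈ P k) → φ x = x := fun x hx => dif_neg hx
  have hpre : ∀ S, φ ⁻¹' S = (⋃ k, P k ∩ g k ⁻¹' S) ∪ ((⋃ k, P k)ᶜ ∩ S) := by
    intro S
    ext x
    by_cases hx : ∃ k, x ∈ P k
    · obtain ⟨k, hk⟩ := hx
      have : ∀ j, x ∈ P j ↔ j = k := fun j =>
        ⟨fun hj => by_contra fun hne => Set.disjoint_left.1 (hd hne) hj hk, fun h => h ▸ hk⟩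
      simp [h1 k x hk, this]
    · have hx' := hx
      push Not at hx'
      simp [h2 x hx, hx']
  have hmeas : Measurable φ := fun S hS => by
    rw [hpre]
    exact (MeasurableSet.iUnion fun k => (hP k).inter (hg k hS)).union
      ((MeasurableSet.iUnion hP).compl.inter hS)
  refine ⟨φ, fun x => ?_, ⟨hmeas, Measure.ext fun S hS => ?_⟩, h1⟩
  · by_cases hx : ∃ k, x ∈ P k
    · obtain ⟨k, hk⟩ := hx
      rw [h1 k x hk, h1 _ _ (hmaps k x hk), hinv k x hk]
    · rw [h2 x hx, h2 x hx]
  · have hU : MeasurableSet (⋃ k, P k) := MeasurableSet.iUnion hP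
    rw [Measure.map_apply hmeas hS, hpre, measure_union _ (hU.compl.inter hS),
      measure_iUnion _ fun k => (hP k).inter (hg k hS)]
    · simp_rw [hμ _ _ hS]
      have hsum : ∑' k, μ (P (σ k) ∩ S) = ∑' k, μ (P k ∩ S) :=
        (Function.Involutive.toPerm σ hσ).tsum_eq fun k => μ (P k ∩ S)
      rw [hsum, ← measure_iUnion _ fun k => (hP k).inter hS, ← Set.iUnion_inter, Set.inter_comm _ S,
        Set.inter_comm _ S, ← Set.sdiff_eq, measure_inter_add_sdiff S hU]
      exact fun i j hij => (hd hij).mono Set.inter_subset_left Set.inter_subset_left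
    · exact fun i j hij => (hd hij).mono Set.inter_subset_left Set.inter_subset_left
    · rw [Set.disjoint_left]
      rintro x hx ⟨hx', -⟩
      obtain ⟨k, hk⟩ := Set.mem_iUnion.1 hx
      exact hx' (Set.mem_iUnion.2 ⟨k, hk.1⟩)

/-! ### Finitely additive symmetric couplings. -/

/-- `K` is a symmetric finitely additive coupling of `ν` with itself, given by its values
`K B C` on rectangles. -/
structure IsSelfCoupling {X : Type*} [MeasurableSpace X] (ν : Measure X)
    (K : Set X → Set X → ℝ) : Prop where
  nonneg : ∀ B C, MeasurableSet B → MeasurableSet C → 0 ≤ K B C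
  symm : ∀ B C, MeasurableSet B → MeasurableSet C → K B C = K C B
  union : ∀ B B' C, MeasurableSet B → MeasurableSet B' → MeasurableSet C → Disjoint B B' →
    K (B ∪ B') C = K B C + K B' C
  univ_right : ∀ B, MeasurableSet B → K B Set.univ = ν.real B

namespace IsSelfCoupling

variable {X : Type*} [MeasurableSpace X] {ν : Measure X} {K : Set X → Set X → ℝ}

theorem empty_left (hK : IsSelfCoupling ν K) {C : Set X} (hC : MeasurableSet C) :
    K ∅ C = 0 := by
  have := hK.union ∅ ∅ C .empty .empty hC (by simp)
  simpa using this

theorem biUnion_left (hK : IsSelfCoupling ν K) {ι : Type*} (s : Finset ι) {B : ι → Set X}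
    (hB : ∀ i, MeasurableSet (B i)) (hd : Pairwise (Function.onFun Disjoint B)) {C : Set X}
    (hC : MeasurableSet C) : K (⋃ i ∈ s, B i) C = ∑ i ∈ s, K (B i) C := by
  classical
  induction s using Finset.induction_on with
  | empty => simpa using hK.empty_left hC
  | insert a s ha ih =>
    rw [Finset.set_biUnion_insert, hK.union _ _ _ (hB a)
      (Finset.measurableSet_biUnion _ fun i _ => hB i) hC, ih, Finset.sum_insert ha]
    refine Set.disjoint_iUnion₂_right.2 fun i hi => hd ?_
    rintro rfl
    exact ha hi

theorem biUnion_right (hK : IsSelfCoupling ν K) {ι : Type*} (s : Finset ι) {B : ι → Set X}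
    (hB : ∀ i, MeasurableSet (B i)) (hd : Pairwise (Function.onFun Disjoint B)) {C : Set X}
    (hC : MeasurableSet C) : K C (⋃ i ∈ s, B i) = ∑ i ∈ s, K C (B i) := by
  rw [hK.symm _ _ hC (Finset.measurableSet_biUnion _ fun i _ => hB i), hK.biUnion_left s hB hd hC]
  exact Finset.sum_congr rfl fun i _ => hK.symm _ _ (hB i) hC

end IsSelfCoupling

theorem iUnion_range_Ioc_of_monotone {f : ℕ → ℝ} (hf : Monotone f) (n : ℕ) :
    ⋃ i ∈ Finset.range n, Set.Ioc (f i) (f (i + 1)) = Set.Ioc (f 0) (f n) := by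
  rw [← hf.biUnion_Ico_Ioc_map_succ 0 n]
  simp

theorem monotone_natCast_div (N : ℕ) : Monotone fun i : ℕ => (i : ℝ) / N := fun i j hij => by
  dsimp only
  gcongr

/-! ### Interval exchanges that realize a coupling on cells. -/

section Exchange

variable {X : Type*} [MeasurableSpace X] [StandardBorelSpace X] {ν : Measure X}
  {h : X → ℝ} {g : ℝ → X}

/-- An exchange of finitely many pairs of intervals of equal lengths, transported to a space that
is isomorphic modulo null sets to the unit interval. -/
theorem exists_involutive_interval_exchange {ι : Type*} [Finite ι]
    (hh : Measurable h) (hg : Measurable g) (hmap : ν.map h = volume.restrict (Set.Ioc 0 1))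
    (hgh : ∀ᵐ x ∂ν, g (h x) = x) (a b : ι → ℝ)
    (hsub : ∀ k, Set.Ioc (a k) (b k) ⊆ Set.Ioc 0 1)
    (hd : Pairwise (Function.onFun Disjoint fun k => Set.Ioc (a k) (b k)))
    (σ : ι → ι) (hσ : Function.Involutive σ) (hlen : ∀ k, b (σ k) - a (σ k) = b k - a k) :
    ∃ φ : X → X, Function.Involutive φ ∧ MeasurePreserving φ ν ν ∧
      ∀ k, ∀ᵐ x ∂ν, h x ∈ Set.Ioc (a k) (b k) → h (φ x) ∈ Set.Ioc (a (σ k)) (b (σ k)) := by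
  set Z : Set ℝ := {t | h (g t) = t}
  have hZ : MeasurableSet Z := measurableSet_eq_fun (hh.comp hg) measurable_id
  have hZae : ∀ᵐ x ∂ν, h x ∈ Z := by
    filter_upwards [hgh] with x hx
    exact congrArg h hx
  set τ : ι → ℝ := fun k => a (σ k) - a k with hτ
  have hτσ : ∀ k, τ (σ k) = - τ k := fun k => by simp [hτ, hσ k]
  have hIτ : ∀ k t, t + τ k ∈ Set.Ioc (a (σ k)) (b (σ k)) ↔ t ∈ Set.Ioc (a k) (b k) := by
    intro k t
    have := hlen k
    simp only [Set.mem_Ioc, hτ]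
    constructor <;> rintro ⟨h1, h2⟩ <;> constructor <;> linarith
  have hvol : ∀ k T, MeasurableSet T →
      ν (h ⁻¹' (Set.Ioc (a k) (b k) ∩ T)) = volume (Set.Ioc (a k) (b k) ∩ T) := by
    intro k T hT
    rw [← Measure.map_apply hh (measurableSet_Ioc.inter hT), hmap,
      Measure.restrict_apply (measurableSet_Ioc.inter hT), Set.inter_eq_left.2]
    exact Set.inter_subset_left.trans (hsub k)
  have hshift : ∀ k T, MeasurableSet T →
      ν (h ⁻¹' (Set.Ioc (a k) (b k) ∩ (fun t => t + τ k) ⁻¹' T)) =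
        ν (h ⁻¹' (Set.Ioc (a (σ k)) (b (σ k)) ∩ T)) := by
    intro k T hT
    rw [hvol k _ (measurable_add_const _ hT), hvol (σ k) _ hT,
      ← measure_preimage_add_right volume (τ k) (Set.Ioc (a (σ k)) (b (σ k)) ∩ T)]
    congr 1
    ext t
    simp only [Set.mem_inter_iff, Set.mem_preimage, hIτ]
  have hZτ : ∀ k, ∀ᵐ x ∂ν, h x ∈ Set.Ioc (a k) (b k) → h x + τ k ∈ Z := by
    intro k
    have h0 : ν (h ⁻¹' (Set.Ioc (a (σ k)) (b (σ k)) ∩ Zᶜ)) = 0 :=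
      measure_mono_null (fun x hx => hx.2) hZae
    rw [← hshift k _ hZ.compl] at h0
    refine measure_mono_null (fun x hx => ?_) h0
    exact Classical.not_imp.1 hx
  -- Since `g` inverts `h` only up to null sets, each piece keeps just the points where inversion
  -- works both before and after the translation; the gluing conditions then hold pointwise.
  set P : ι → Set X := fun k =>
    {x | g (h x) = x} ∩ h ⁻¹' (Set.Ioc (a k) (b k) ∩ (fun t => t + τ k) ⁻¹' Z) with hPdef
  have hX₀ : MeasurableSet {x | g (h x) = x} := measurableSet_eq_fun (hg.comp hh) measurable_id
  have hPae : ∀ k, ∀ᵐ x ∂ν, x ∈ P k ↔ h x ∈ Set.Ioc (a k) (b k) := by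
    intro k
    filter_upwards [hgh, hZτ k] with x h1 h2
    exact ⟨fun hx => hx.2.1, fun hx => ⟨h1, hx, h2 hx⟩⟩
  have hmaps : ∀ k, ∀ x ∈ P k, g (h x + τ k) ∈ P (σ k) := by
    rintro k x ⟨h1, h2, h3⟩
    have hz : h (g (h x + τ k)) = h x + τ k := h3
    refine ⟨?_, ?_, ?_⟩
    · show g (h (g (h x + τ k))) = _
      rw [hz]
    · rw [hz]
      exact (hIτ k _).2 h2
    · show h (g (h (g (h x + τ k)) + τ (σ k))) = h (g (h x + τ k)) + τ (σ k)
      have h1' : g (h x) = x := h1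
      rw [hz, hτσ, add_neg_cancel_right, h1']
  have hinv : ∀ k, ∀ x ∈ P k, g (h (g (h x + τ k)) + τ (σ k)) = x := by
    rintro k x ⟨h1, h2, h3⟩
    have hz : h (g (h x + τ k)) = h x + τ k := h3
    rw [hz, hτσ, add_neg_cancel_right]
    exact h1
  have hνP : ∀ k S, MeasurableSet S →
      ν (P k ∩ (fun x => g (h x + τ k)) ⁻¹' S) = ν (P (σ k) ∩ S) := by
    intro k S hS
    have e1 : ν (P k ∩ (fun x => g (h x + τ k)) ⁻¹' S) =
        ν (h ⁻¹' (Set.Ioc (a k) (b k) ∩ (fun t => t + τ k) ⁻¹' (g ⁻¹' S))) := by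
      apply measure_congr
      filter_upwards [hPae k] with x hx
      exact propext (and_congr hx Iff.rfl)
    have e2 : ν (P (σ k) ∩ S) = ν (h ⁻¹' (Set.Ioc (a (σ k)) (b (σ k)) ∩ (g ⁻¹' S))) := by
      apply measure_congr
      filter_upwards [hPae (σ k), hgh] with x hx hx'
      refine propext (and_congr hx ?_)
      show x ∈ S ↔ g (h x) ∈ S
      rw [hx']
    rw [e1, e2, hshift k _ (hg hS)]
  obtain ⟨φ, hφ, hφν, hφP⟩ := exists_involutive_measurePreserving_of_pieces ν P
    (fun k => hX₀.inter (hh (measurableSet_Ioc.inter (measurable_add_const _ hZ))))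
    (fun k l hkl => Set.disjoint_left.2 fun x hx hy =>
      Set.disjoint_left.1 (hd hkl) hx.2.1 hy.2.1) σ hσ
    (fun k x => g (h x + τ k)) (fun k => hg.comp (hh.add_const _)) hmaps hinv hνP
  refine ⟨φ, hφ, hφν, fun k => ?_⟩
  filter_upwards [hPae k] with x hx hxk
  have hxP := hx.2 hxk
  have hz : h (g (h x + τ k)) = h x + τ k := hxP.2.2
  rw [hφP k x hxP, hz]
  exact (hIτ k _).2 hxk

/-- A symmetric coupling is realized by an involution on the intervals of length `1 / N`. -/
theorem exists_involutive_measureReal_cells [IsProbabilityMeasure ν]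
    {K : Set X → Set X → ℝ} (hK : IsSelfCoupling ν K)
    (hh : Measurable h) (hg : Measurable g) (hmem : ∀ x, h x ∈ Set.Ioc (0 : ℝ) 1)
    (hmap : ν.map h = volume.restrict (Set.Ioc 0 1))
    (hgh : ∀ᵐ x ∂ν, g (h x) = x) {N : ℕ} (hN : 0 < N) :
    ∃ φ : X → X, Function.Involutive φ ∧ MeasurePreserving φ ν ν ∧
      ∀ i < N, ∀ j < N, ν.real (φ ⁻¹' (h ⁻¹' Set.Ioc ((i : ℝ) / N) ((i + 1 : ℕ) / N)) ∩
          h ⁻¹' Set.Ioc ((j : ℝ) / N) ((j + 1 : ℕ) / N)) =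
        K (h ⁻¹' Set.Ioc ((i : ℝ) / N) ((i + 1 : ℕ) / N))
          (h ⁻¹' Set.Ioc ((j : ℝ) / N) ((j + 1 : ℕ) / N)) := by
  have hN' : (0 : ℝ) < N := Nat.cast_pos.2 hN
  set C : ℕ → Set X := fun i => h ⁻¹' Set.Ioc ((i : ℝ) / N) ((i + 1 : ℕ) / N) with hC
  have hCm : ∀ i, MeasurableSet (C i) := fun i => hh measurableSet_Ioc
  have hIoc_disj := (monotone_natCast_div N).pairwise_disjoint_on_Ioc_succ
  have hCd : Pairwise (Function.onFun Disjoint C) := fun i j hij =>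
    (hIoc_disj hij).preimage h
  have hIoc_cover : ⋃ i ∈ Finset.range N, Set.Ioc ((i : ℝ) / N) ((i + 1 : ℕ) / N) =
      Set.Ioc 0 1 := by
    rw [iUnion_range_Ioc_of_monotone (monotone_natCast_div N)]
    simp [hN'.ne']
  have hCcover : ⋃ i ∈ Finset.range N, C i = Set.univ := by
    have : ⋃ i ∈ Finset.range N, C i =
        h ⁻¹' (⋃ i ∈ Finset.range N, Set.Ioc ((i : ℝ) / N) ((i + 1 : ℕ) / N)) := by
      simp only [Set.preimage_iUnion, hC]
    rw [this, hIoc_cover]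
    exact Set.eq_univ_of_forall hmem
  have hνIoc : ∀ s t : ℝ, 0 ≤ s → t ≤ 1 → s ≤ t → ν.real (h ⁻¹' Set.Ioc s t) = t - s := by
    intro s t hs ht hst
    rw [Measure.real, ← Measure.map_apply hh measurableSet_Ioc, hmap,
      Measure.restrict_apply measurableSet_Ioc, Set.inter_eq_left.2 (Set.Ioc_subset_Ioc hs ht),
      Real.volume_Ioc, ENNReal.toReal_ofReal (sub_nonneg.2 hst)]
  have hle1 : ∀ i, i < N → ((i + 1 : ℕ) : ℝ) / N ≤ 1 := fun i hi =>
    (div_le_one hN').2 (by exact_mod_cast hi)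
  -- The cut points of cell `i`: its `j`-th piece has length `K (C i) (C j)`, and the pieces fill
  -- the cell because the second marginal condition makes these lengths sum to `ν.real (C i)`.
  set r : ℕ → ℕ → ℝ := fun i j => (i : ℝ) / N + ∑ l ∈ Finset.range j, K (C i) (C l) with hr
  have hr0 : ∀ i, r i 0 = i / N := fun i => by simp [hr]
  have hrN : ∀ i, i < N → r i N = (i + 1 : ℕ) / N := by
    intro i hi
    have : ν.real (C i) = (i + 1 : ℕ) / N - i / N :=
      hνIoc _ _ (by positivity) (hle1 i hi) (monotone_natCast_div N (Nat.le_succ i))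
    simp only [hr]
    rw [← hK.biUnion_right _ hCm hCd (hCm i), hCcover, hK.univ_right _ (hCm i), this]
    ring
  have hrsucc : ∀ i j, r i (j + 1) - r i j = K (C i) (C j) := fun i j => by
    simp only [hr, Finset.sum_range_succ]
    ring
  have hrmono : ∀ i, Monotone (r i) := fun i => monotone_nat_of_le_succ fun j => by
    have := hK.nonneg _ _ (hCm i) (hCm j)
    linarith [hrsucc i j]
  have hrsub : ∀ i < N, ∀ j < N, Set.Ioc (r i j) (r i (j + 1)) ⊆
      Set.Ioc ((i : ℝ) / N) ((i + 1 : ℕ) / N) := fun i hi j hj =>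
    Set.Ioc_subset_Ioc (by rw [← hr0]; exact hrmono i (Nat.zero_le _))
      (by rw [← hrN i hi]; exact hrmono i hj)
  have hdisj : Pairwise (Function.onFun Disjoint
      fun k : Fin N × Fin N => Set.Ioc (r k.1 k.2) (r k.1 (k.2 + 1))) := by
    rintro ⟨i, j⟩ ⟨i', j'⟩ hne
    by_cases hi : i = i'
    · subst hi
      have hj : (j : ℕ) ≠ j' := fun e => hne (by rw [Fin.ext e])
      exact (hrmono i).pairwise_disjoint_on_Ioc_succ hj
    · have hi' : (i : ℕ) ≠ i' := fun e => hi (Fin.ext e)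
      exact (hIoc_disj hi').mono (hrsub _ i.2 _ j.2) (hrsub _ i'.2 _ j'.2)
  obtain ⟨φ, hφ, hφν, hφI⟩ := exists_involutive_interval_exchange hh hg hmap hgh
    (fun k : Fin N × Fin N => r k.1 k.2) (fun k => r k.1 (k.2 + 1))
    (fun k => (hrsub _ k.1.2 _ k.2.2).trans
      (Set.Ioc_subset_Ioc (by positivity) (hle1 _ k.1.2))) hdisj Prod.swap (fun _ => rfl)
    (fun k => by
      simp only [Prod.fst_swap, Prod.snd_swap, hrsucc]
      exact hK.symm _ _ (hCm _) (hCm _))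
  refine ⟨φ, hφ, hφν, fun i hi j hj => ?_⟩
  -- Piece `(j, l)` is sent into cell `l`, so the part of `C j` landing in `C i` is piece `(j, i)`
  -- up to a null set.
  have hae : (φ ⁻¹' C i ∩ C j : Set X) =ᵐ[ν] h ⁻¹' Set.Ioc (r j i) (r j (i + 1)) := by
    filter_upwards [ae_all_iff.2 hφI] with x hx
    apply propext
    show φ x ∈ C i ∧ x ∈ C j ↔ h x ∈ Set.Ioc (r j i) (r j (i + 1))
    constructor
    · rintro ⟨h1, h2⟩
      have h2' : h x ∈ ⋃ l ∈ Finset.range N, Set.Ioc (r j l) (r j (l + 1)) := by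
        rw [iUnion_range_Ioc_of_monotone (hrmono j), hr0, hrN j hj]
        exact h2
      obtain ⟨l, hl, hxl⟩ := Set.mem_iUnion₂.1 h2'
      have hlN := Finset.mem_range.1 hl
      have h3 := hrsub l hlN j hj (hx (⟨j, hj⟩, ⟨l, hlN⟩) hxl)
      have : l = i := by
        by_contra hne
        exact Set.disjoint_left.1 (hCd hne) h3 h1
      exact this ▸ hxl
    · intro h1
      exact ⟨hrsub i hi j hj (hx (⟨j, hj⟩, ⟨i, hi⟩) h1), hrsub j hj i hi h1⟩
  rw [measureReal_congr hae, hνIoc, hrsucc, hK.symm _ _ (hCm _) (hCm _)]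
  · exact le_trans (by positivity) ((hr0 j).symm.le.trans (hrmono j (Nat.zero_le _)))
  · exact ((hrmono j hi).trans (hrN j hj).le).trans (hle1 j hj)
  · exact hrmono j (Nat.le_succ i)

end Exchange

/-! ### Couplings as limits of graphs of involutions. -/

theorem MeasureTheory.MeasurePreserving.isSelfCoupling {X : Type*} [MeasurableSpace X]
    {ν : Measure X} [IsFiniteMeasure ν] {φ : X → X} (hφ : Function.Involutive φ)
    (hν : MeasurePreserving φ ν ν) : IsSelfCoupling ν fun B C => ν.real (φ ⁻¹' B ∩ C) where
  nonneg _ _ _ _ := measureReal_nonneg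
  symm B C hB hC := by
    have h : φ ⁻¹' (φ ⁻¹' B ∩ C) = φ ⁻¹' C ∩ B := by
      rw [Set.preimage_inter, ← Set.preimage_comp, hφ.comp_self, Set.preimage_id, Set.inter_comm]
    rw [← h, Measure.real, Measure.real,
      hν.measure_preimage ((hν.measurable hB).inter hC).nullMeasurableSet]
  union B B' C hB hB' hC hd := by
    rw [Set.preimage_union, Set.union_inter_distrib_right]
    exact measureReal_union ((hd.preimage φ).mono Set.inter_subset_left Set.inter_subset_left)
      ((hν.measurable hB').inter hC)
  univ_right B hB := by
    rw [Set.inter_univ, Measure.real, Measure.real, hν.measure_preimage hB.nullMeasurableSet]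

theorem IsSelfCoupling.eq_on_biUnion {X ι : Type*} [MeasurableSpace X] {ν : Measure X}
    {K L : Set X → Set X → ℝ} (hK : IsSelfCoupling ν K) (hL : IsSelfCoupling ν L)
    {C : ι → Set X} (hC : ∀ i, MeasurableSet (C i))
    (hd : Pairwise (Function.onFun Disjoint C)) (s t : Finset ι)
    (h : ∀ i ∈ s, ∀ j ∈ t, K (C i) (C j) = L (C i) (C j)) :
    K (⋃ i ∈ s, C i) (⋃ j ∈ t, C j) = L (⋃ i ∈ s, C i) (⋃ j ∈ t, C j) := by
  have ht : MeasurableSet (⋃ j ∈ t, C j) := Finset.measurableSet_biUnion _ fun i _ => hC i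
  rw [hK.biUnion_left s hC hd ht, hL.biUnion_left s hC hd ht]
  refine Finset.sum_congr rfl fun i hi => ?_
  rw [hK.biUnion_right t hC hd (hC i), hL.biUnion_right t hC hd (hC i)]
  exact Finset.sum_congr rfl fun j hj => h i hi j hj

/-- The threshold `p` lies on the grid of mesh `1 / N`, so no cell straddles it. An integer `z`
allows for thresholds outside `[0, 1]`. -/
theorem preimage_Iic_eq_biUnion_Ioc {X : Type*} {h : X → ℝ} (hmem : ∀ x, h x ∈ Set.Ioc (0 : ℝ) 1)
    {N : ℕ} (hN : 0 < N) {p : ℝ} {z : ℤ} (hz : p * N = z) :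
    h ⁻¹' Set.Iic p = ⋃ i ∈ (Finset.range N).filter fun i : ℕ => (i : ℤ) + 1 ≤ z,
      h ⁻¹' Set.Ioc ((i : ℝ) / N) ((i + 1 : ℕ) / N) := by
  have hN' : (0 : ℝ) < N := Nat.cast_pos.2 hN
  ext x
  simp only [Set.mem_iUnion, Finset.mem_filter, Finset.mem_range, Set.mem_preimage, Set.mem_Iic,
    exists_prop]
  constructor
  · intro hx
    have hcover : h x ∈ ⋃ i ∈ Finset.range N, Set.Ioc ((i : ℝ) / N) ((i + 1 : ℕ) / N) := by
      rw [iUnion_range_Ioc_of_monotone (monotone_natCast_div N)]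
      simpa [hN'.ne'] using hmem x
    obtain ⟨i, hi, hxi⟩ := Set.mem_iUnion₂.1 hcover
    refine ⟨i, ⟨Finset.mem_range.1 hi, ?_⟩, hxi⟩
    have h1 : (i : ℝ) < p * N := (div_lt_iff₀ hN').1 (hxi.1.trans_le hx)
    rw [hz] at h1
    exact_mod_cast h1
  · rintro ⟨i, ⟨-, hi⟩, hxi⟩
    refine hxi.2.trans ((div_le_iff₀ hN').2 ?_)
    rw [hz]
    exact_mod_cast hi

theorem exists_int_eq_mul_factorial (p : ℚ) {n : ℕ} (hn : p.den ≤ n) :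
    ∃ z : ℤ, (p : ℝ) * (n.factorial : ℕ) = z := by
  obtain ⟨c, hc⟩ := Nat.dvd_factorial p.den_pos hn
  refine ⟨p.num * c, ?_⟩
  have hp : (p : ℝ) * p.den = p.num := by exact_mod_cast Rat.mul_den_eq_num p
  rw [hc]
  push_cast
  rw [← mul_assoc, hp]

/-- Every symmetric coupling of an atomless standard Borel probability space with itself is a
limit of graphs of measure preserving involutions, in the sense of agreeing eventually on a family
of test sets which generates the measurable sets modulo null sets. -/
theorem IsSelfCoupling.exists_seq_involutive {X : Type*} [MeasurableSpace X]
    [StandardBorelSpace X] {ν : Measure X} [IsProbabilityMeasure ν] [NullSingletonClass ν]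
    {K : Set X → Set X → ℝ} (hK : IsSelfCoupling ν K) :
    ∃ (h : X → ℝ) (φ : ℕ → X → X), Measurable h ∧ (∀ n, Function.Involutive (φ n)) ∧
      (∀ n, MeasurePreserving (φ n) ν ν) ∧
      (∀ B, MeasurableSet B → ∃ T, MeasurableSet T ∧ B =ᵐ[ν] h ⁻¹' T) ∧
      ∀ p q : ℚ, ∀ᶠ n in atTop, ν.real (φ n ⁻¹' (h ⁻¹' Set.Iic (p : ℝ)) ∩ h ⁻¹' Set.Iic (q : ℝ)) =
        K (h ⁻¹' Set.Iic (p : ℝ)) (h ⁻¹' Set.Iic (q : ℝ)) := by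
  obtain ⟨h, g, hh, hg, hmem, hmap, hgh⟩ := exists_map_eq_restrict_Ioc ν
  -- Factorials are eventually divisible by every denominator, so each pair of rational thresholds
  -- is on the grid for all large `n`.
  choose φ hφ hφν hφK using fun n : ℕ =>
    exists_involutive_measureReal_cells hK hh hg hmem hmap hgh n.factorial_pos
  refine ⟨h, φ, hh, hφ, hφν, fun B hB => ⟨g ⁻¹' B, hg hB, ?_⟩, fun p q => ?_⟩
  · filter_upwards [hgh] with x hx
    exact propext (by show x ∈ B ↔ g (h x) ∈ B; rw [hx])
  · filter_upwards [eventually_ge_atTop p.den, eventually_ge_atTop q.den] with n hp hq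
    obtain ⟨y, hy⟩ := exists_int_eq_mul_factorial p hp
    obtain ⟨z, hz⟩ := exists_int_eq_mul_factorial q hq
    rw [preimage_Iic_eq_biUnion_Ioc hmem n.factorial_pos hy,
      preimage_Iic_eq_biUnion_Ioc hmem n.factorial_pos hz]
    refine ((hφν n).isSelfCoupling (hφ n)).eq_on_biUnion hK (fun i => hh measurableSet_Ioc)
      (fun i j hij => ?_) _ _ fun i hi j hj => ?_
    · exact ((monotone_natCast_div n.factorial).pairwise_disjoint_on_Ioc_succ hij).preimage h
    · exact hφK n i (Finset.mem_range.1 (Finset.mem_filter.1 hi).1) j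
        (Finset.mem_range.1 (Finset.mem_filter.1 hj).1)

/-! ### Extension of convergence from a π-system. -/

/-- The common bound by a finite `μ` does two things: it gives dominated convergence for countable
disjoint unions, and it lets sets be replaced by `μ`-a.e. equal ones. -/
theorem tendsto_measureReal_of_isPiSystem {X : Type*} [MeasurableSpace X] {μ : Measure X}
    [IsFiniteMeasure μ] {F : ℕ → Measure X} {G : Measure X} (hF : ∀ n, F n ≤ μ) (hG : G ≤ μ)
    {S : Set (Set X)} (hS : IsPiSystem S) (hSm : ∀ s ∈ S, MeasurableSet s)
    (hgen : ∀ t, MeasurableSet t → ∃ t', MeasurableSet[MeasurableSpace.generateFrom S] t' ∧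
      t =ᵐ[μ] t')
    (huniv : Tendsto (fun n => (F n).real Set.univ) atTop (𝓝 (G.real Set.univ)))
    (h : ∀ s ∈ S, Tendsto (fun n => (F n).real s) atTop (𝓝 (G.real s)))
    {t : Set X} (ht : MeasurableSet t) :
    Tendsto (fun n => (F n).real t) atTop (𝓝 (G.real t)) := by
  have hFf : ∀ n, IsFiniteMeasure (F n) := fun n => isFiniteMeasure_of_le μ (hF n)
  have hGf : IsFiniteMeasure G := isFiniteMeasure_of_le μ hG
  have hle : MeasurableSpace.generateFrom S ≤ ‹MeasurableSpace X› :=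
    MeasurableSpace.generateFrom_le hSm
  obtain ⟨t', ht', htt'⟩ := hgen t ht
  have hcongr : ∀ ρ ≤ μ, ρ.real t = ρ.real t' := fun ρ hρ =>
    measureReal_congr ((Measure.absolutelyContinuous_of_le hρ).ae_eq htt')
  rw [hcongr G hG]
  simp_rw [fun n => hcongr (F n) (hF n)]
  refine MeasurableSpace.induction_on_inter
    (C := fun t _ => Tendsto (fun n => (F n).real t) atTop (𝓝 (G.real t))) rfl hS ?_ h ?_ ?_ t' ht'
  · simp
  · intro t ht ih
    rw [measureReal_compl (hle _ ht)]
    simp_rw [fun n => measureReal_compl (μ := F n) (hle _ ht)]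
    exact huniv.sub ih
  · intro f hd hf ih
    have hsum : ∀ ρ ≤ μ, IsFiniteMeasure ρ → ρ.real (⋃ i, f i) = ∑' i, ρ.real (f i) := by
      intro ρ _ _
      rw [Measure.real, measure_iUnion hd fun i => hle _ (hf i),
        ENNReal.tsum_toReal_eq fun i => measure_ne_top ρ _]
      rfl
    have hmono : ∀ ρ ≤ μ, ∀ s, ρ.real s ≤ μ.real s := fun ρ hρ s =>
      ENNReal.toReal_mono (measure_ne_top μ s) (hρ s)
    rw [hsum G hG hGf]
    simp_rw [fun n => hsum (F n) (hF n) (hFf n)]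
    refine tendsto_tsum_of_dominated_convergence (bound := fun i => μ.real (f i)) ?_ ih ?_
    · exact ENNReal.summable_toReal ((measure_iUnion hd fun i => hle _ (hf i)) ▸ measure_ne_top μ _)
    · refine Eventually.of_forall fun n i => ?_
      rw [Real.norm_of_nonneg measureReal_nonneg]
      exact hmono _ (hF n) _

theorem measureReal_withDensity_ofReal {X : Type*} [MeasurableSpace X] {μ : Measure X} {f : X → ℝ}
    (hf : Integrable f μ) (hf0 : 0 ≤ᵐ[μ] f) {s : Set X} (hs : MeasurableSet s) :
    (μ.withDensity fun x => ENNReal.ofReal (f x)).real s = ∫ x in s, f x ∂μ := by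
  rw [Measure.real, withDensity_apply _ hs,
    integral_eq_lintegral_of_nonneg_ae (ae_restrict_of_ae hf0) hf.1.restrict]

/-! ### The relatively independent self-joining. -/

/-- The relatively independent self-joining of `μ` over the σ-algebra `A`, evaluated at `B × C`. -/
noncomputable def condCoupling {X : Type*} (A : MeasurableSpace X) [MeasurableSpace X]
    (μ : Measure X) (B C : Set X) : ℝ :=
  ∫ x in C, (μ[B.indicator fun _ => (1 : ℝ) | A]) x ∂μ

theorem condExp_indicator_nonneg {X : Type*} {A : MeasurableSpace X} [MeasurableSpace X]
    {μ : Measure X} (B : Set X) : 0 ≤ᵐ[μ] μ[B.indicator fun _ => (1 : ℝ) | A] :=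
  condExp_nonneg (ae_of_all _ fun _ => Set.indicator_nonneg (fun _ _ => zero_le_one) _)

theorem measureReal_withDensity_condExp {X : Type*} {A : MeasurableSpace X} [MeasurableSpace X]
    {μ : Measure X} {B C : Set X} (hC : MeasurableSet C) :
    (μ.withDensity fun x => ENNReal.ofReal ((μ[B.indicator fun _ => (1 : ℝ) | A]) x)).real C =
      condCoupling A μ B C :=
  measureReal_withDensity_ofReal integrable_condExp (condExp_indicator_nonneg B) hC

section CondCoupling

variable {X : Type*} {A : MeasurableSpace X} [mX : MeasurableSpace X] {μ : Measure X}
  [IsFiniteMeasure μ]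

theorem integrable_indicator_one {B : Set X} (hB : MeasurableSet B) :
    Integrable (B.indicator fun _ => (1 : ℝ)) μ :=
  (integrable_const 1).indicator hB

theorem condExp_indicator_le_one (hA : A ≤ mX) {B : Set X} (hB : MeasurableSet B) :
    μ[B.indicator fun _ => (1 : ℝ) | A] ≤ᵐ[μ] fun _ => 1 := by
  have h := condExp_mono (m := A) (integrable_indicator_one (μ := μ) hB)
    (integrable_const (1 : ℝ)) (ae_of_all _ fun x => Set.indicator_le_self' (by simp) x)
  rwa [condExp_const hA] at h

/-- The bounded `A`-measurable factor `E[1_B | A]` can be pulled out of a conditional expectation;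
the resulting form is visibly symmetric. -/
theorem condCoupling_eq_integral_mul (hA : A ≤ mX) {B C : Set X} (hB : MeasurableSet B)
    (hC : MeasurableSet C) :
    condCoupling A μ B C = ∫ x, (μ[B.indicator fun _ => (1 : ℝ) | A]) x *
      (μ[C.indicator fun _ => (1 : ℝ) | A]) x ∂μ := by
  have h := condExp_stronglyMeasurable_mul_of_bound (μ := μ) hA
    (stronglyMeasurable_condExp (f := B.indicator fun _ => (1 : ℝ)))
    (integrable_indicator_one hC) 1 (by
      filter_upwards [condExp_indicator_nonneg (A := A) (μ := μ) B,
        condExp_indicator_le_one (μ := μ) hA hB] with x h0 h1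
      rw [Real.norm_of_nonneg h0]
      exact h1)
  have h2 := integral_congr_ae h
  rw [integral_condExp hA] at h2
  simp only [Pi.mul_apply] at h2
  rw [← h2, condCoupling, ← integral_indicator hC]
  congr 1 with x
  by_cases hx : x ∈ C <;> simp [hx]

theorem condCoupling_symm (hA : A ≤ mX) {B C : Set X} (hB : MeasurableSet B)
    (hC : MeasurableSet C) : condCoupling A μ B C = condCoupling A μ C B := by
  rw [condCoupling_eq_integral_mul hA hB hC, condCoupling_eq_integral_mul hA hC hB]
  simp_rw [mul_comm]

theorem condCoupling_of_measurableSet (hA : A ≤ mX) {B C : Set X} (hB : MeasurableSet B)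
    (hC : MeasurableSet[A] C) : condCoupling A μ B C = μ.real (B ∩ C) := by
  rw [condCoupling, setIntegral_condExp hA (integrable_indicator_one hB) hC,
    integral_indicator_const _ hB, measureReal_restrict_apply hB, smul_eq_mul, mul_one]

theorem isSelfCoupling_condCoupling (hA : A ≤ mX) : IsSelfCoupling μ (condCoupling A μ) where
  nonneg B C _ _ := integral_nonneg_of_ae (ae_restrict_of_ae (condExp_indicator_nonneg B))
  symm _ _ hB hC := condCoupling_symm hA hB hC
  union B B' C hB hB' hC hd := by
    rw [condCoupling_symm hA (hB.union hB') hC, condCoupling_symm hA hB hC,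
      condCoupling_symm hA hB' hC]
    exact setIntegral_union hd hB' integrable_condExp.integrableOn integrable_condExp.integrableOn
  univ_right B hB := by
    rw [condCoupling_of_measurableSet hA hB MeasurableSet.univ, Set.inter_univ]

theorem withDensity_condExp_le (hA : A ≤ mX) {B : Set X} (hB : MeasurableSet B) :
    (μ.withDensity fun x => ENNReal.ofReal ((μ[B.indicator fun _ => (1 : ℝ) | A]) x)) ≤ μ := by
  conv_rhs => rw [← withDensity_one (μ := μ)]
  refine withDensity_mono ?_
  filter_upwards [condExp_indicator_le_one (μ := μ) hA hB] with x hx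
  exact ENNReal.ofReal_le_one.2 hx

/-- If the graphs of measure preserving maps converge to the relatively independent self-joining
on a π-system which generates the measurable sets modulo null sets, they do so everywhere. -/
theorem tendsto_condCoupling_of_isPiSystem (hA : A ≤ mX) {φ : ℕ → X → X}
    (hφ : ∀ n, MeasurePreserving (φ n) μ μ) {S : Set (Set X)} (hS : IsPiSystem S)
    (hSm : ∀ s ∈ S, MeasurableSet s)
    (hgen : ∀ t, MeasurableSet t → ∃ t', MeasurableSet[MeasurableSpace.generateFrom S] t' ∧
      t =ᵐ[μ] t')
    (h : ∀ B ∈ S, ∀ C ∈ S, Tendsto (fun n => μ.real (φ n ⁻¹' B ∩ C)) atTop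
      (𝓝 (condCoupling A μ B C)))
    {B C : Set X} (hB : MeasurableSet B) (hC : MeasurableSet C) :
    Tendsto (fun n => μ.real (φ n ⁻¹' B ∩ C)) atTop (𝓝 (condCoupling A μ B C)) := by
  have hK := isSelfCoupling_condCoupling (μ := μ) hA
  have hpre : ∀ n B, MeasurableSet B → μ.real (φ n ⁻¹' B) = μ.real B := fun n B hB => by
    rw [Measure.real, Measure.real, (hφ n).measure_preimage hB.nullMeasurableSet]
  -- The two arguments are freed one at a time: here `B` stays in the π-system and the set function
  -- of `C` has density `E[1_B | A]` in the limit.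
  have hright : ∀ B ∈ S, ∀ C, MeasurableSet C →
      Tendsto (fun n => μ.real (φ n ⁻¹' B ∩ C)) atTop (𝓝 (condCoupling A μ B C)) := by
    intro B hB C hC
    have hBm := hSm B hB
    have key := tendsto_measureReal_of_isPiSystem (μ := μ)
      (F := fun n => μ.restrict (φ n ⁻¹' B))
      (G := μ.withDensity fun x => ENNReal.ofReal ((μ[B.indicator fun _ => (1 : ℝ) | A]) x))
      (fun n => Measure.restrict_le_self) (withDensity_condExp_le hA hBm) hS hSm hgen ?_ ?_ hC
    · rw [measureReal_withDensity_condExp hC] at key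
      simpa only [measureReal_restrict_apply hC, Set.inter_comm C] using key
    · rw [measureReal_withDensity_condExp .univ, hK.univ_right B hBm]
      simp only [measureReal_restrict_apply MeasurableSet.univ, Set.univ_inter, hpre _ B hBm]
      exact tendsto_const_nhds
    · intro s hs
      rw [measureReal_withDensity_condExp (hSm s hs)]
      simpa only [measureReal_restrict_apply (hSm s hs), Set.inter_comm s] using h B hB s hs
  -- Now `C` is fixed and `B` varies; the relevant measures are pushforwards of `μ.restrict C`,
  -- which stay below `μ` because `φ n` preserves `μ`.
  have hmap : ∀ n B, MeasurableSet B →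
      ((μ.restrict C).map (φ n)).real B = μ.real (φ n ⁻¹' B ∩ C) := fun n B hB => by
    rw [map_measureReal_apply (hφ n).measurable hB,
      measureReal_restrict_apply ((hφ n).measurable hB)]
  have key := tendsto_measureReal_of_isPiSystem (μ := μ)
    (F := fun n => (μ.restrict C).map (φ n))
    (G := μ.withDensity fun x => ENNReal.ofReal ((μ[C.indicator fun _ => (1 : ℝ) | A]) x))
    (fun n => ?_) (withDensity_condExp_le hA hC) hS hSm hgen ?_ ?_ hB
  · rw [measureReal_withDensity_condExp hB] at key
    simpa only [hmap _ B hB, condCoupling_symm hA hB hC] using key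
  · exact (Measure.map_mono Measure.restrict_le_self (hφ n).measurable).trans_eq (hφ n).map_eq
  · rw [measureReal_withDensity_condExp .univ, hK.univ_right C hC]
    simp only [hmap _ _ MeasurableSet.univ, Set.preimage_univ, Set.univ_inter]
    exact tendsto_const_nhds
  · intro s hs
    rw [measureReal_withDensity_condExp (hSm s hs), condCoupling_symm hA hC (hSm s hs)]
    simpa only [hmap _ s (hSm s hs)] using hright s hs C hC

end CondCoupling

/-! ### Weak convergence of Koopman operators. -/

/-- The Koopman operators of `φ n` converge weakly to the conditional expectation. -/
theorem tendsto_setIntegral_comp_condExp {X : Type*} {A : MeasurableSpace X} [MeasurableSpace X]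
    {μ : Measure X} {φ : ℕ → X → X}
    (hφ : ∀ n, MeasurePreserving (φ n) μ μ)
    (h : ∀ B C, MeasurableSet B → MeasurableSet C →
      Tendsto (fun n => μ.real (φ n ⁻¹' B ∩ C)) atTop (𝓝 (condCoupling A μ B C)))
    {f : X → ℝ} (hf : Integrable f μ) {Q : Set X} (hQ : MeasurableSet Q) :
    Tendsto (fun n => ∫ x in Q, f (φ n x) ∂μ) atTop (𝓝 (∫ x in Q, (μ[f | A]) x ∂μ)) := by
  have hint : ∀ {f : X → ℝ}, Integrable f μ → ∀ n, Integrable (fun x => f (φ n x)) μ :=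
    fun hf n => (hφ n).integrable_comp_of_integrable hf
  refine Integrable.induction (fun f : X → ℝ => Tendsto (fun n => ∫ x in Q, f (φ n x) ∂μ) atTop
    (𝓝 (∫ x in Q, (μ[f | A]) x ∂μ))) ?_ ?_ ?_ ?_ hf
  · intro c s hs _
    have e1 : ∀ n, ∫ x in Q, s.indicator (fun _ => c) (φ n x) ∂μ =
        c * μ.real (φ n ⁻¹' s ∩ Q) := by
      intro n
      have : (fun x => s.indicator (fun _ => c) (φ n x)) = (φ n ⁻¹' s).indicator fun _ => c := by
        ext x
        by_cases hx : φ n x ∈ s <;> simp [hx]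
      rw [this, integral_indicator_const _ ((hφ n).measurable hs),
        measureReal_restrict_apply ((hφ n).measurable hs), smul_eq_mul, mul_comm]
    have e2 : ∫ x in Q, (μ[s.indicator fun _ => c | A]) x ∂μ = c * condCoupling A μ s Q := by
      have : (s.indicator fun _ => c) = c • s.indicator fun _ => (1 : ℝ) := by
        ext x
        by_cases hx : x ∈ s <;> simp [hx]
      rw [condCoupling, ← integral_const_mul, this]
      exact integral_congr_ae (ae_restrict_of_ae (condExp_smul c _ A))
    simp_rw [e1]
    rw [e2]
    exact (h s Q hs hQ).const_mul c
  · intro f g _ hf hg h1 h2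
    have e1 : ∀ n, ∫ x in Q, (f + g) (φ n x) ∂μ =
        ∫ x in Q, f (φ n x) ∂μ + ∫ x in Q, g (φ n x) ∂μ := fun n =>
      integral_add (hint hf n).integrableOn (hint hg n).integrableOn
    have e2 : ∫ x in Q, (μ[f + g | A]) x ∂μ =
        ∫ x in Q, (μ[f | A]) x ∂μ + ∫ x in Q, (μ[g | A]) x ∂μ := by
      rw [← integral_add integrable_condExp.integrableOn integrable_condExp.integrableOn]
      exact integral_congr_ae (ae_restrict_of_ae (condExp_add hf hg A))
    simp_rw [e1]
    rw [e2]
    exact h1.add h2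
  -- Both integrals are 1-Lipschitz in the L¹ norm, uniformly in `n`, so the functions with the
  -- desired limit form a closed set.
  · have b1 : ∀ (f g : X →₁[μ] ℝ) n,
        |∫ x in Q, f (φ n x) ∂μ - ∫ x in Q, g (φ n x) ∂μ| ≤ dist f g := by
      intro f g n
      have hfi := hint (L1.integrable_coeFn f) n
      have hgi := hint (L1.integrable_coeFn g) n
      have hfg := ((L1.integrable_coeFn f).sub (L1.integrable_coeFn g)).norm.1
      have hmap := integral_map (hφ n).measurable.aemeasurable
        (f := fun x => ‖f x - g x‖) (by rw [(hφ n).map_eq]; exact hfg)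
      rw [(hφ n).map_eq] at hmap
      rw [← integral_sub hfi.integrableOn hgi.integrableOn, L1.dist_eq_integral_dist]
      simp_rw [dist_eq_norm]
      rw [hmap]
      exact (abs_integral_le_integral_abs).trans
        (setIntegral_le_integral (hfi.sub hgi).abs (ae_of_all _ fun _ => abs_nonneg _))
    have b2 : ∀ f g : X →₁[μ] ℝ,
        |∫ x in Q, (μ[f | A]) x ∂μ - ∫ x in Q, (μ[g | A]) x ∂μ| ≤ dist f g := by
      intro f g
      have hsub : (fun x => (μ[f | A]) x - (μ[g | A]) x) =ᵐ[μ] μ[⇑f - ⇑g | A] :=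
        (condExp_sub (L1.integrable_coeFn f) (L1.integrable_coeFn g) A).symm
      rw [← integral_sub integrable_condExp.integrableOn integrable_condExp.integrableOn,
        L1.dist_eq_integral_dist, integral_congr_ae (ae_restrict_of_ae hsub)]
      exact (abs_integral_le_integral_abs).trans
        ((setIntegral_le_integral integrable_condExp.abs (ae_of_all _ fun _ => abs_nonneg _)).trans
          (integral_abs_condExp_le _))
    refine isClosed_of_closure_subset fun f hf => ?_
    refine Metric.tendsto_atTop.2 fun ε hε => ?_
    obtain ⟨g, hg, hfg⟩ := Metric.mem_closure_iff.1 hf (ε / 3) (by positivity)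
    obtain ⟨N, hN⟩ := Metric.tendsto_atTop.1 hg (ε / 3) (by positivity)
    refine ⟨N, fun n hn => ?_⟩
    have h1 := b1 f g n
    have h2 := b2 f g
    have h3 := hN n hn
    rw [Real.dist_eq, abs_lt] at h3 ⊢
    rw [abs_le] at h1 h2
    constructor <;> linarith
  · intro f g hfg hf h1
    have e1 : ∀ n, ∫ x in Q, g (φ n x) ∂μ = ∫ x in Q, f (φ n x) ∂μ := fun n =>
      integral_congr_ae (ae_restrict_of_ae
        ((hφ n).quasiMeasurePreserving.ae_eq_comp hfg.symm))
    simp_rw [e1]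
    rwa [integral_congr_ae (ae_restrict_of_ae (condExp_congr_ae hfg.symm))]

/-! ### Products of joinings. -/

/-- The tensor product is `A × A`-measurable and has the right integral over rectangles with sides
in `A` by Fubini. Read as equality of two finite measures, this passes to all of `A × A` by the π-λ
theorem. -/
theorem condExp_prod_indicator {Ω : Type*} {A : MeasurableSpace Ω} [mΩ : MeasurableSpace Ω]
    {ν : Measure Ω} [IsFiniteMeasure ν] (hA : A ≤ mΩ) {B B' : Set Ω} (hB : MeasurableSet B)
    (hB' : MeasurableSet B') :
    (fun p : Ω × Ω => (ν[B.indicator fun _ => (1 : ℝ) | A]) p.1 *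
        (ν[B'.indicator fun _ => (1 : ℝ) | A]) p.2) =ᵐ[ν.prod ν]
      (ν.prod ν)[(B ×ˢ B').indicator fun _ => (1 : ℝ) | A.prod A] := by
  have hAA : A.prod A ≤ mΩ.prod mΩ :=
    sup_le_sup (MeasurableSpace.comap_mono hA) (MeasurableSpace.comap_mono hA)
  set b := ν[B.indicator fun _ => (1 : ℝ) | A] with hb
  set b' := ν[B'.indicator fun _ => (1 : ℝ) | A] with hb'
  have hgi : Integrable (fun p : Ω × Ω => b p.1 * b' p.2) (ν.prod ν) :=
    integrable_condExp.mul_prod integrable_condExp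
  have hg0 : 0 ≤ᵐ[ν.prod ν] fun p : Ω × Ω => b p.1 * b' p.2 := by
    filter_upwards [Measure.quasiMeasurePreserving_fst.ae (condExp_indicator_nonneg (A := A) B),
      Measure.quasiMeasurePreserving_snd.ae (condExp_indicator_nonneg (A := A) B')] with p h1 h2
    exact mul_nonneg h1 h2
  have hBB : MeasurableSet (B ×ˢ B') := hB.prod hB'
  have hrect : ∀ S T, MeasurableSet[A] S → MeasurableSet[A] T →
      ((ν.prod ν).withDensity fun p => ENNReal.ofReal (b p.1 * b' p.2)) (S ×ˢ T) =
        (ν.prod ν).restrict (B ×ˢ B') (S ×ˢ T) := by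
    intro S T hS hT
    have hST : MeasurableSet (S ×ˢ T) := (hA _ hS).prod (hA _ hT)
    have : IsFiniteMeasure ((ν.prod ν).withDensity fun p => ENNReal.ofReal (b p.1 * b' p.2)) :=
      isFiniteMeasure_withDensity_ofReal hgi.2
    rw [← ENNReal.toReal_eq_toReal_iff' (measure_ne_top _ _) (measure_ne_top _ _)]
    refine (measureReal_withDensity_ofReal hgi hg0 hST).trans ?_
    rw [setIntegral_prod_mul]
    have h1 : ∫ x in S, b x ∂ν = ν.real (B ∩ S) := condCoupling_of_measurableSet hA hB hS
    have h2 : ∫ x in T, b' x ∂ν = ν.real (B' ∩ T) := condCoupling_of_measurableSet hA hB' hT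
    rw [h1, h2, Measure.restrict_apply hST, Set.prod_inter_prod, Measure.prod_prod,
      ENNReal.toReal_mul, Set.inter_comm S, Set.inter_comm T]
    rfl
  refine ae_eq_condExp_of_forall_setIntegral_eq hAA (integrable_indicator_one hBB)
    (fun s _ _ => hgi.integrableOn) (fun s hs _ => ?_) ?_
  · have : IsFiniteMeasure ((ν.prod ν).withDensity fun p => ENNReal.ofReal (b p.1 * b' p.2)) :=
      isFiniteMeasure_withDensity_ofReal hgi.2
    have key := ext_on_measurableSpace_of_generate_finite (mΩ.prod mΩ)
      (μ := (ν.prod ν).withDensity fun p => ENNReal.ofReal (b p.1 * b' p.2))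
      (ν := (ν.prod ν).restrict (B ×ˢ B'))
      (Set.image2 (· ×ˢ ·) {s | MeasurableSet[A] s} {t | MeasurableSet[A] t})
      (by rintro _ ⟨S, hS, T, hT, rfl⟩; exact hrect S T hS hT) hAA
      (@generateFrom_prod Ω Ω A A).symm (@isPiSystem_prod Ω Ω A A)
      (by
        have := hrect _ _ (@MeasurableSet.univ Ω A) (@MeasurableSet.univ Ω A)
        rwa [Set.univ_prod_univ] at this) hs
    rw [← measureReal_withDensity_ofReal hgi hg0 (hAA _ hs), Measure.real, key,
      integral_indicator_const _ hBB, measureReal_restrict_apply hBB, smul_eq_mul, mul_one,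
      Measure.restrict_apply (hAA _ hs), Set.inter_comm]
    rfl
  · have h1 : StronglyMeasurable[A.prod A] fun p : Ω × Ω => b p.1 :=
      stronglyMeasurable_condExp.comp_measurable (@measurable_fst Ω Ω A A)
    have h2 : StronglyMeasurable[A.prod A] fun p : Ω × Ω => b' p.2 :=
      stronglyMeasurable_condExp.comp_measurable (@measurable_snd Ω Ω A A)
    exact (h1.mul h2).aestronglyMeasurable

theorem condCoupling_prod {Ω : Type*} {A : MeasurableSpace Ω} [mΩ : MeasurableSpace Ω]
    {ν : Measure Ω} [IsFiniteMeasure ν] (hA : A ≤ mΩ) {B B' : Set Ω} (hB : MeasurableSet B)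
    (hB' : MeasurableSet B') (C C' : Set Ω) :
    condCoupling (A.prod A) (ν.prod ν) (B ×ˢ B') (C ×ˢ C') =
      condCoupling A ν B C * condCoupling A ν B' C' := by
  rw [condCoupling, ← integral_congr_ae (ae_restrict_of_ae (condExp_prod_indicator hA hB hB')),
    setIntegral_prod_mul]
  rfl

/-! ### Completed σ-algebras and approximating involutions. -/

/-- A Borel map need not be measurable for the completed σ-algebra, but a measure preserving one
pulls null measurable sets back to null measurable sets. -/
theorem measurePreserving_conj_of_completion {Ω X : Type*} [MeasurableSpace Ω] [MeasurableSpace X]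
    {ν : Measure Ω} {e : Ω ≃ X} (he : Measurable e)
    (hs : ∀ s, MeasurableSet s → NullMeasurableSet (e.symm ⁻¹' s) (ν.map e))
    (hs' : ∀ s, NullMeasurableSet (e.symm ⁻¹' s) (ν.map e) → MeasurableSet s) {ψ : X → X}
    (hψ : MeasurePreserving ψ (ν.map e) (ν.map e)) :
    MeasurePreserving (e.symm ∘ ψ ∘ e) ν ν := by
  have hpre : ∀ s : Set Ω, e ⁻¹' (e.symm ⁻¹' s) = s := fun s => by
    rw [← Set.preimage_comp, Equiv.symm_comp_self, Set.preimage_id]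
  have hφm : Measurable (e.symm ∘ ψ ∘ e) := fun s hsm => by
    apply hs'
    have := (hs s hsm).preimage hψ.quasiMeasurePreserving
    convert this using 1
    ext x
    simp
  refine ⟨hφm, Measure.ext fun s hsm => ?_⟩
  have hν : ∀ T, NullMeasurableSet T (ν.map e) → ν (e ⁻¹' T) = ν.map e T := fun T hT =>
    (Measure.map_apply₀ he.aemeasurable hT).symm
  rw [Measure.map_apply hφm hsm]
  calc ν (e ⁻¹' (ψ ⁻¹' (e.symm ⁻¹' s))) = ν.map e (ψ ⁻¹' (e.symm ⁻¹' s)) :=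
        hν _ ((hs s hsm).preimage hψ.quasiMeasurePreserving)
    _ = ν.map e (e.symm ⁻¹' s) := hψ.measure_preimage (hs s hsm)
    _ = ν (e ⁻¹' (e.symm ⁻¹' s)) := (hν _ (hs s hsm)).symm
    _ = ν s := by rw [hpre]

/-- A standard probability space is a standard Borel space up to null sets. -/
theorem IsStandardProbabilitySpace.exists_equiv_standardBorel.{u} {Ω : Type u} [mΩ : MeasurableSpace Ω]
    {ν : Measure Ω} (hν : IsStandardProbabilitySpace ν) :
    ∃ (X : Type u) (_ : MeasurableSpace X) (_ : StandardBorelSpace X) (e : Ω ≃ X), Measurable e ∧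
      (∀ s, MeasurableSet s → ∃ T, MeasurableSet T ∧ s =ᵐ[ν] e ⁻¹' T) ∧
      ∀ ψ : X → X, MeasurePreserving ψ (ν.map e) (ν.map e) →
        MeasurePreserving (e.symm ∘ ψ ∘ e) ν ν := by
  rcases hν with hν | ⟨m₀, h, hm₀, hs⟩
  · refine ⟨Ω, mΩ, hν, Equiv.refl Ω, measurable_id, fun s hs => ⟨s, hs, EventuallyEq.rfl⟩,
      fun ψ hψ => ?_⟩
    simpa using hψ
  -- Here `e` is the identity from the completed σ-algebra to `m₀`, measurable in this direction
  -- only; `ν.trim h` is the pushforward along it.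
  · have he : @Measurable Ω Ω mΩ m₀ (Equiv.refl Ω) := fun s hs => h s hs
    have htrim : ν.trim h = @Measure.map Ω Ω mΩ m₀ (Equiv.refl Ω) ν := trim_eq_map h
    rw [htrim] at hs
    refine ⟨Ω, m₀, hm₀, Equiv.refl Ω, he, fun s hsm => ?_, fun ψ hψ => ?_⟩
    · obtain ⟨T, hT, hsT⟩ := (hs s).1 hsm
      exact ⟨T, hT, @ae_of_ae_map Ω Ω mΩ m₀ ν _ (@Measurable.aemeasurable Ω Ω mΩ m₀ _ ν he) _ hsT⟩
    · exact @measurePreserving_conj_of_completion Ω Ω mΩ m₀ ν _ he (fun s => (hs s).1)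
        (fun s => (hs s).2) ψ hψ

/-- On an atomless standard probability space there are measure preserving involutions whose
graphs converge to the relatively independent self-joining over a given sub-σ-algebra. -/
theorem exists_seq_involutive_tendsto_condCoupling {Ω : Type*} {A : MeasurableSpace Ω}
    [mΩ : MeasurableSpace Ω] {ν : Measure Ω} [IsProbabilityMeasure ν] [NullSingletonClass ν]
    (hν : IsStandardProbabilitySpace ν) (hA : A ≤ mΩ) :
    ∃ φ : ℕ → Ω → Ω, (∀ n, Function.Involutive (φ n)) ∧ (∀ n, MeasurePreserving (φ n) ν ν) ∧
      ∀ B C, MeasurableSet B → MeasurableSet C →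
        Tendsto (fun n => ν.real (φ n ⁻¹' B ∩ C)) atTop (𝓝 (condCoupling A ν B C)) := by
  obtain ⟨X, _, _, e, he, hnull, hmp⟩ := hν.exists_equiv_standardBorel
  have hreal : ∀ T, MeasurableSet T → (ν.map e).real T = ν.real (e ⁻¹' T) := fun T hT =>
    map_measureReal_apply he hT
  have hK := isSelfCoupling_condCoupling (μ := ν) hA
  -- Only the coupling is carried to `X`, not `A`, which may contain sets that are not Borel there.
  have hK₀ : IsSelfCoupling (ν.map e) fun B C => condCoupling A ν (e ⁻¹' B) (e ⁻¹' C) :=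
    { nonneg := fun B C hB hC => hK.nonneg _ _ (he hB) (he hC)
      symm := fun B C hB hC => hK.symm _ _ (he hB) (he hC)
      union := fun B B' C hB hB' hC hd =>
        hK.union _ _ _ (he hB) (he hB') (he hC) (hd.preimage e)
      univ_right := fun B hB => (hK.univ_right _ (he hB)).trans (hreal B hB).symm }
  have : IsProbabilityMeasure (ν.map e) := Measure.isProbabilityMeasure_map he.aemeasurable
  have : NullSingletonClass (ν.map e) := ⟨fun x => by
    rw [Measure.map_apply he (measurableSet_singleton x)]
    exact Set.Subsingleton.measure_zero (fun a ha b hb => e.injective (ha.trans hb.symm)) ν⟩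
  obtain ⟨f, ψ, hf, hψ, hψν, hgen, hlim⟩ := hK₀.exists_seq_involutive
  have hφν : ∀ n, MeasurePreserving (e.symm ∘ ψ n ∘ e) ν ν := fun n => hmp _ (hψν n)
  refine ⟨fun n => e.symm ∘ ψ n ∘ e, fun n x => by simp [hψ n (e x)], hφν, fun B C hB hC => ?_⟩
  refine tendsto_condCoupling_of_isPiSystem hA hφν
    (S := {s | ∃ T ∈ ⋃ q : ℚ, {Set.Iic (q : ℝ)}, (f ∘ e) ⁻¹' T = s})
    (Real.isPiSystem_Iic_rat.comap (f ∘ e)) ?_ ?_ ?_ hB hC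
  · rintro _ ⟨T, hT, rfl⟩
    obtain ⟨q, rfl⟩ := Set.mem_iUnion.1 hT
    exact (hf.comp he) measurableSet_Iic
  · intro s hs
    obtain ⟨T, hT, hsT⟩ := hnull s hs
    obtain ⟨T', hT', hTT'⟩ := hgen T hT
    refine ⟨(f ∘ e) ⁻¹' T', ?_, hsT.trans (ae_of_ae_map he.aemeasurable hTT')⟩
    have hcomap := MeasurableSpace.comap_generateFrom (f := f ∘ e)
      (s := ⋃ q : ℚ, {Set.Iic (q : ℝ)})
    rw [← Real.borel_eq_generateFrom_Iic_rat, ← BorelSpace.measurable_eq (α := ℝ)] at hcomap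
    exact (congrArg (fun m => MeasurableSet[m] ((f ∘ e) ⁻¹' T')) hcomap).mp ⟨T', hT', rfl⟩
  · rintro _ ⟨T, hT, rfl⟩ _ ⟨T', hT', rfl⟩
    obtain ⟨p, rfl⟩ := Set.mem_iUnion.1 hT
    obtain ⟨q, rfl⟩ := Set.mem_iUnion.1 hT'
    refine tendsto_const_nhds.congr' ?_
    filter_upwards [hlim p q] with n hn
    refine hn.symm.trans ((hreal _ ?_).trans ?_)
    · exact ((hψν n).measurable (hf measurableSet_Iic)).inter (hf measurableSet_Iic)
    · congr 1
      ext x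
      simp

theorem tendsto_condCoupling_prod {Ω : Type*} {A : MeasurableSpace Ω} [mΩ : MeasurableSpace Ω]
    {ν : Measure Ω} [IsFiniteMeasure ν] (hA : A ≤ mΩ) (hAA : A.prod A ≤ mΩ.prod mΩ)
    {φ : ℕ → Ω → Ω} (hφ : ∀ n, MeasurePreserving (φ n) ν ν)
    (h : ∀ B C, MeasurableSet B → MeasurableSet C →
      Tendsto (fun n => ν.real (φ n ⁻¹' B ∩ C)) atTop (𝓝 (condCoupling A ν B C)))
    {Q R : Set (Ω × Ω)} (hQ : MeasurableSet Q) (hR : MeasurableSet R) :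
    Tendsto (fun n => (ν.prod ν).real (Prod.map (φ n) (φ n) ⁻¹' Q ∩ R)) atTop
      (𝓝 (condCoupling (A.prod A) (ν.prod ν) Q R)) := by
  refine tendsto_condCoupling_of_isPiSystem hAA (fun n => (hφ n).prod (hφ n))
    (S := Set.image2 (· ×ˢ ·) {s | MeasurableSet s} {t | MeasurableSet t}) isPiSystem_prod
    ?_ ?_ ?_ hQ hR
  · rintro _ ⟨s, hs, t, ht, rfl⟩
    exact MeasurableSet.prod hs ht
  · intro t ht
    refine ⟨t, ?_, EventuallyEq.rfl⟩
    rwa [generateFrom_prod]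
  · rintro _ ⟨B, hB, B', hB', rfl⟩ _ ⟨C, hC, C', hC', rfl⟩
    rw [condCoupling_prod hA hB hB']
    have e : ∀ n, (ν.prod ν).real (Prod.map (φ n) (φ n) ⁻¹' B ×ˢ B' ∩ C ×ˢ C') =
        ν.real (φ n ⁻¹' B ∩ C) * ν.real (φ n ⁻¹' B' ∩ C') := fun n => by
      rw [← measureReal_prod_prod, ← Set.prod_inter_prod]
      rfl
    simp_rw [e]
    exact (h B C hB hC).mul (h B' C' hB' hC')

/-! ### Graphons and the conclusion. -/

theorem IsGraphon.integrable {Ω : Type*} [MeasurableSpace Ω] {ν : Measure Ω} [IsFiniteMeasure ν]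
    {W : Ω × Ω → ℝ} (hW : IsGraphon ν W) : Integrable W (ν.prod ν) := by
  refine Integrable.of_bound hW.aemeasurable.aestronglyMeasurable 1 ?_
  filter_upwards [hW.mem_Icc] with p hp
  rw [Real.norm_of_nonneg hp.1]
  exact hp.2

theorem IsGraphon.condExp_prod {Ω : Type*} {A : MeasurableSpace Ω} [mΩ : MeasurableSpace Ω]
    {ν : Measure Ω} [IsFiniteMeasure ν] {W : Ω × Ω → ℝ} (hW : IsGraphon ν W)
    (hAA : A.prod A ≤ mΩ.prod mΩ) : IsGraphon ν ((ν.prod ν)[W | A.prod A]) where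
  aemeasurable := integrable_condExp.1.aemeasurable
  mem_Icc := by
    have h1 := condExp_mono (m := A.prod A) hW.integrable (integrable_const (1 : ℝ))
      (hW.mem_Icc.mono fun _ hp => hp.2)
    rw [condExp_const hAA] at h1
    filter_upwards [condExp_nonneg (m := A.prod A) (hW.mem_Icc.mono fun _ hp => hp.1), h1]
      with p h0 h1
    exact ⟨h0, h1⟩
  symm := by
    have hsw : MeasurePreserving Prod.swap (ν.prod ν) (ν.prod ν) := Measure.measurePreserving_swap
    have hswA : Measurable[A.prod A, A.prod A] (Prod.swap : Ω × Ω → Ω × Ω) :=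
      @measurable_swap Ω Ω A A
    have hset : ∀ (f : Ω × Ω → ℝ) s, ∫ p in s, f p.swap ∂(ν.prod ν) =
        ∫ p in Prod.swap ⁻¹' s, f p ∂(ν.prod ν) := fun f s => by
      have := hsw.setIntegral_preimage_emb MeasurableEquiv.prodComm.measurableEmbedding f
        (Prod.swap ⁻¹' s)
      rwa [← Set.preimage_comp, Prod.swap_swap_eq, Set.preimage_id] at this
    -- The swap preserves both `ν.prod ν` and `A.prod A`, so the swapped conditional expectation is
    -- the one of the swapped `W`, which is `W` itself.
    refine ae_eq_condExp_of_forall_setIntegral_eq hAA hW.integrable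
      (g := fun p => ((ν.prod ν)[W | A.prod A]) p.swap)
      (fun s _ _ => (hsw.integrable_comp_of_integrable integrable_condExp).integrableOn)
      (fun s hs _ => ?_)
      (stronglyMeasurable_condExp.comp_measurable hswA).aestronglyMeasurable
    rw [hset, setIntegral_condExp hAA hW.integrable (hswA hs), ← hset]
    exact integral_congr_ae (ae_restrict_of_ae hW.symm)

theorem theorem4p3 {Ω : Type*} (A : MeasurableSpace Ω) [mΩ : MeasurableSpace Ω]
    (ν : Measure Ω) [IsProbabilityMeasure ν] [NullSingletonClass ν] (hν : IsStandardProbabilitySpace ν)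
    (hA : A ≤ mΩ) (W : Ω × Ω → ℝ) (hW : IsGraphon ν W) :
    (ν.prod ν)[W | A.prod A] ∈ graphonEnvelope ν W := by
  have hAA : A.prod A ≤ mΩ.prod mΩ :=
    sup_le_sup (MeasurableSpace.comap_mono hA) (MeasurableSpace.comap_mono hA)
  obtain ⟨φ, hφ, hφν, hlim⟩ := exists_seq_involutive_tendsto_condCoupling hν hA
  refine ⟨hW.condExp_prod hAA, fun n => MeasurableEquiv.ofInvolutive (φ n) (hφ n)
    (hφν n).measurable, hφν, fun Q hQ => ?_⟩
  exact tendsto_setIntegral_comp_condExp (fun n => (hφν n).prod (hφν n))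
    (fun _ _ => tendsto_condCoupling_prod hA hAA hφν hlim) hW.integrable hQ
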